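/- Let $(M,g)$ be a compact connected smooth Riemannian manifold without boundary, of dimension $n$. Let $X$ be a smooth vector field, $\lambda,\mu\in C^\infty(M)$ smooth functions and $\eta$ a smooth $1$-form on $M$ such that $(M,g)$ is an almost $\eta$-Ricci soliton with these data, that is, $$\mathrm{Ric}+\tfrac12\mathcal{L}_Xg=\lambda g+\mu\,\eta\otimes\eta .$$ Let $h\in C^\infty(M)$ be a Hodge–de Rham potential of $X$, that is, $X=\nabla h+Y$ for a smooth vector field $Y$ with $\operatorname{div}Y=0$. Suppose that, with the same $\lambda,\mu,\eta$, $(M,g)$ is also a gradient almost $\eta$-Ricci soliton with potential function $f\in C^\infty(M)$, that is, $$\mathrm{Ric}+\nabla^2f=\lambda g+\mu\,\eta\otimes\eta ,$$ where $\nabla^2 f$ is the Hessian of $f$. Then there is a constant $c\in\mathbb{R}$ with $f=h+c$ on $M$. -/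

import Mathlib

open Bundle Set
open scoped Manifold ContDiff Topology

noncomputable section

namespace Riem

/-- The model space `ℝⁿ`. -/
abbrev E (n : ℕ) : Type := EuclideanSpace ℝ (Fin n)

/-- A smooth Riemannian metric on the tangent bundle of an `n`-manifold without boundary. -/
abbrev Metric (n : ℕ) (M : Type*) [TopologicalSpace M] [ChartedSpace (E n) M]
    [IsManifold (𝓡 n) ∞ M] :=
  ContMDiffRiemannianMetric (𝓡 n) ∞ (E n) (fun p : M ↦ TangentSpace (𝓡 n) p)

/-- The partial derivative `∂ᵢ F` of a function on (an open subset of) `ℝⁿ`. -/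
def pd {n : ℕ} (i : Fin n) (F : E n → ℝ) (x : E n) : ℝ :=
  fderiv ℝ F x (EuclideanSpace.single i 1)

section Charts

variable {n : ℕ} {M : Type*} [TopologicalSpace M] [ChartedSpace (E n) M]

/-- The coordinate vector field `∂ᵢ` of the chart `e`, at the point with coordinates `x`. -/
def frame (e : OpenPartialHomeomorph M (E n)) (i : Fin n) (x : E n) :
    TangentSpace (𝓡 n) (e.symm x) :=
  mfderiv (𝓡 n) (𝓡 n) e.symm x (EuclideanSpace.single i 1 : E n)

/-- The component `Xⁱ` of a vector field in the chart `e`, so that `X = Xⁱ ∂ᵢ`. -/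
def vecComp (e : OpenPartialHomeomorph M (E n)) (X : ∀ p : M, TangentSpace (𝓡 n) p)
    (i : Fin n) (x : E n) : ℝ :=
  (EuclideanSpace.proj i : E n →L[ℝ] ℝ) (mfderiv (𝓡 n) (𝓡 n) e (e.symm x) (X (e.symm x)))

/-- The component `ηᵢ = η(∂ᵢ)` of a 1-form in the chart `e`. -/
def formComp (e : OpenPartialHomeomorph M (E n)) (η : ∀ p : M, TangentSpace (𝓡 n) p →L[ℝ] ℝ)
    (i : Fin n) (x : E n) : ℝ :=
  η (e.symm x) (frame e i x)

/-- The function `u` read in the chart `e`. -/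
def funComp (e : OpenPartialHomeomorph M (E n)) (u : M → ℝ) (x : E n) : ℝ := u (e.symm x)

/-- Smoothness of a vector field. -/
def SmoothVectorField [IsManifold (𝓡 n) ∞ M] (X : ∀ p : M, TangentSpace (𝓡 n) p) : Prop :=
  ContMDiff (𝓡 n) (𝓡 n).tangent ∞ (fun p ↦ (⟨p, X p⟩ : TangentBundle (𝓡 n) M))

/-- Smoothness of a 1-form. -/
def SmoothOneForm [IsManifold (𝓡 n) ∞ M] (η : ∀ p : M, TangentSpace (𝓡 n) p →L[ℝ] ℝ) : Prop :=
  ContMDiff (𝓡 n) ((𝓡 n).prod 𝓘(ℝ, E n →L[ℝ] ℝ)) ∞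
    (fun p ↦ TotalSpace.mk' (E n →L[ℝ] ℝ) (E := fun p : M ↦ TangentSpace (𝓡 n) p →L[ℝ] ℝ) p (η p))

variable [IsManifold (𝓡 n) ∞ M] (g : Metric n M)

/-- The matrix `(g_{ij})` of the metric in the chart `e`. -/
def gMat (e : OpenPartialHomeomorph M (E n)) (x : E n) : Matrix (Fin n) (Fin n) ℝ :=
  Matrix.of fun i j ↦ g.inner (e.symm x) (frame e i x) (frame e j x)

/-- The Christoffel symbol `Γᵏᵢⱼ = ½ gᵏˡ (∂ᵢ gⱼₗ + ∂ⱼ gᵢₗ - ∂ₗ gᵢⱼ)`. -/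
def christoffel (e : OpenPartialHomeomorph M (E n)) (k i j : Fin n) (x : E n) : ℝ :=
  (1 / 2) * ∑ l, (gMat g e x)⁻¹ k l *
    (pd i (fun y ↦ gMat g e y j l) x + pd j (fun y ↦ gMat g e y i l) x
      - pd l (fun y ↦ gMat g e y i j) x)

/-- The component `Ricᵢⱼ = ∂ₖ Γᵏᵢⱼ - ∂ⱼ Γᵏᵢₖ + Γᵏₖₗ Γˡᵢⱼ - Γᵏⱼₗ Γˡᵢₖ` of the Ricci tensor. -/
def ricci (e : OpenPartialHomeomorph M (E n)) (i j : Fin n) (x : E n) : ℝ :=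
  ∑ k, (pd k (christoffel g e k i j) x - pd j (christoffel g e k i k) x
    + ∑ l, (christoffel g e k k l x * christoffel g e l i j x
      - christoffel g e k j l x * christoffel g e l i k x))

/-- The component `(∇²u)ᵢⱼ = ∂ᵢ∂ⱼ u - Γᵏᵢⱼ ∂ₖ u` of the Hessian. -/
def hess (e : OpenPartialHomeomorph M (E n)) (u : M → ℝ) (i j : Fin n) (x : E n) : ℝ :=
  pd i (pd j (funComp e u)) x - ∑ k, christoffel g e k i j x * pd k (funComp e u) x

/-- The component `(𝓛_X g)ᵢⱼ = X(g(∂ᵢ, ∂ⱼ)) - g([X, ∂ᵢ], ∂ⱼ) - g(∂ᵢ, [X, ∂ⱼ])` of the Lie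
derivative of the metric, where `[X, ∂ᵢ] = -(∂ᵢ Xᵏ) ∂ₖ`. -/
def lieMetric (e : OpenPartialHomeomorph M (E n)) (X : ∀ p : M, TangentSpace (𝓡 n) p)
    (i j : Fin n) (x : E n) : ℝ :=
  ∑ k, (vecComp e X k x * pd k (fun y ↦ gMat g e y i j) x
    + pd i (vecComp e X k) x * gMat g e x k j + pd j (vecComp e X k) x * gMat g e x i k)

/-- The divergence `(1 / √det g) ∂ⱼ(√det g Xʲ)`. -/
def divergence (e : OpenPartialHomeomorph M (E n)) (X : ∀ p : M, TangentSpace (𝓡 n) p)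
    (x : E n) : ℝ :=
  (1 / √(gMat g e x).det) * ∑ j, pd j (fun y ↦ √(gMat g e y).det * vecComp e X j y) x

/-- The metric at a point as a bilinear form on the tangent space. -/
def bilin (p : M) : LinearMap.BilinForm ℝ (TangentSpace (𝓡 n) p) :=
  LinearMap.mk₂ ℝ (fun v w ↦ g.inner p v w) (by simp) (by simp) (by simp) (by simp)

theorem bilin_nondegenerate (p : M) : (bilin g p).Nondegenerate := by
  refine ⟨fun v hv ↦ ?_, fun v hv ↦ ?_⟩ <;>
  · by_contra h0
    exact (g.pos p v h0).ne' (hv v)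

instance tangentFiniteDimensional (p : M) : FiniteDimensional ℝ (TangentSpace (𝓡 n) p) :=
  inferInstanceAs (FiniteDimensional ℝ (E n))

/-- The gradient `∇u`: the vector field with `g(∇u, v) = du(v)` for every tangent vector `v`. -/
def grad (u : M → ℝ) (p : M) : TangentSpace (𝓡 n) p :=
  ((bilin g p).toDual (bilin_nondegenerate g p)).symm
    (mfderiv (𝓡 n) 𝓘(ℝ, ℝ) u p : TangentSpace (𝓡 n) p →L[ℝ] ℝ).toLinearMap

theorem inner_grad (u : M → ℝ) (p : M) (v : TangentSpace (𝓡 n) p) :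
    g.inner p (grad g u p) v = (mfderiv (𝓡 n) 𝓘(ℝ, ℝ) u p : TangentSpace (𝓡 n) p →L[ℝ] ℝ) v :=
  LinearMap.BilinForm.apply_toDual_symm_apply
    (hB := bilin_nondegenerate g p) _ v

/-- `(M, g)` with the smooth field `X`, smooth functions `lam`, `mu` and 1-form `η` is an almost
`η`-Ricci soliton: `Ric + ½ 𝓛_X g = lam g + mu η ⊗ η`. An equation of tensors is an equation of
components in every chart of the atlas. -/
structure IsAlmostEtaRicciSoliton (X : ∀ p : M, TangentSpace (𝓡 n) p) (lam mu : M → ℝ)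
    (η : ∀ p : M, TangentSpace (𝓡 n) p →L[ℝ] ℝ) : Prop where
  smooth_X : SmoothVectorField X
  smooth_lam : ContMDiff (𝓡 n) 𝓘(ℝ, ℝ) ∞ lam
  smooth_mu : ContMDiff (𝓡 n) 𝓘(ℝ, ℝ) ∞ mu
  smooth_η : SmoothOneForm η
  eqn : ∀ e ∈ atlas (E n) M, ∀ x ∈ e.target, ∀ i j : Fin n,
    ricci g e i j x + (1 / 2) * lieMetric g e X i j x
      = lam (e.symm x) * gMat g e x i j + mu (e.symm x) * (formComp e η i x * formComp e η j x)

/-- `(M, g)` is a gradient almost `η`-Ricci soliton with potential `f`: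
`Ric + ∇²f = lam g + mu η ⊗ η`. -/
structure IsGradientAlmostEtaRicciSoliton (f lam mu : M → ℝ)
    (η : ∀ p : M, TangentSpace (𝓡 n) p →L[ℝ] ℝ) : Prop where
  smooth_f : ContMDiff (𝓡 n) 𝓘(ℝ, ℝ) ∞ f
  smooth_lam : ContMDiff (𝓡 n) 𝓘(ℝ, ℝ) ∞ lam
  smooth_mu : ContMDiff (𝓡 n) 𝓘(ℝ, ℝ) ∞ mu
  smooth_η : SmoothOneForm η
  eqn : ∀ e ∈ atlas (E n) M, ∀ x ∈ e.target, ∀ i j : Fin n,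
    ricci g e i j x + hess g e f i j x
      = lam (e.symm x) * gMat g e x i j + mu (e.symm x) * (formComp e η i x * formComp e η j x)

/-- `h` is a Hodge–de Rham potential of the vector field `X`: `h` is smooth and `X = ∇h + Y` for a
smooth vector field `Y` with `div Y = 0`. -/
def IsHodgeDeRhamPotential (X : ∀ p : M, TangentSpace (𝓡 n) p) (h : M → ℝ) : Prop :=
  ContMDiff (𝓡 n) 𝓘(ℝ, ℝ) ∞ h ∧
  ∃ Y : ∀ p : M, TangentSpace (𝓡 n) p, SmoothVectorField Y ∧
    (∀ e ∈ atlas (E n) M, ∀ x ∈ e.target, divergence g e Y x = 0) ∧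
    ∀ p, X p = grad g h p + Y p

end Charts

end Riem

end

/-! The metric trace of the difference of the two soliton equations is `div X = Δf`. Tracing
`𝓛_{∇h} g = 2 ∇²h` gives `div ∇h = Δh`, so `div X = Δh` as `div Y = 0`. Hence `f - h` is harmonic,
and a harmonic function on a closed connected manifold is constant by the strong maximum principle.

For the maximum principle (Hopf), let `u` have a local maximum at `x` without being constant near
`x`: a small ball free of maximum points touches the maximum set in a single point `z`. With a
defining function `s` of that ball, a small multiple of the barrier `s + β s²` added to `u` moves
the maximum to a point where the operator is positive, which the second derivative test forbids.
-/

namespace Riem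

section PartialDerivatives

variable {n : ℕ}

theorem clm_apply_eq_sum_single {F : Type*} [NormedAddCommGroup F] [NormedSpace ℝ F]
    (A : E n →L[ℝ] F) (v : E n) : A v = ∑ i, v i • A (EuclideanSpace.single i 1) := by
  conv_lhs => rw [← (EuclideanSpace.basisFun (Fin n) ℝ).sum_repr v]
  simp only [map_sum, map_smul, EuclideanSpace.basisFun_repr, EuclideanSpace.basisFun_apply]

variable {F G : E n → ℝ} {x : E n}

theorem fderiv_apply_eq_sum_pd (F : E n → ℝ) (x v : E n) :
    fderiv ℝ F x v = ∑ i, v i * pd i F x :=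
  clm_apply_eq_sum_single _ v

theorem contDiffAt_pd {k m : ℕ∞ω} (hF : ContDiffAt ℝ k F x) (hm : m + 1 ≤ k) (i : Fin n) :
    ContDiffAt ℝ m (pd i F) x :=
  (hF.fderiv_right hm).clm_apply contDiffAt_const

theorem differentiableAt_pd (hF : ContDiffAt ℝ 2 F x) (i : Fin n) :
    DifferentiableAt ℝ (pd i F) x :=
  (contDiffAt_pd (m := 1) hF (by norm_num) i).differentiableAt (by norm_num)

theorem pd_congr (h : F =ᶠ[𝓝 x] G) (i : Fin n) : pd i F x = pd i G x := by
  rw [pd, pd, h.fderiv_eq]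

theorem pd_const (c : ℝ) (i : Fin n) : pd i (fun _ ↦ c) x = 0 := by
  simp [pd]

theorem pd_add (hF : DifferentiableAt ℝ F x) (hG : DifferentiableAt ℝ G x) (i : Fin n) :
    pd i (fun y ↦ F y + G y) x = pd i F x + pd i G x := by
  rw [pd, fderiv_fun_add hF hG]
  rfl

theorem pd_mul (hF : DifferentiableAt ℝ F x) (hG : DifferentiableAt ℝ G x) (i : Fin n) :
    pd i (fun y ↦ F y * G y) x = pd i F x * G x + F x * pd i G x := by
  simp [pd, fderiv_fun_mul hF hG, add_comm, mul_comm]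

theorem pd_sum {ι : Type*} (s : Finset ι) {H : ι → E n → ℝ}
    (hH : ∀ k ∈ s, DifferentiableAt ℝ (H k) x) (i : Fin n) :
    pd i (fun y ↦ ∑ k ∈ s, H k y) x = ∑ k ∈ s, pd i (H k) x := by
  rw [pd, fderiv_fun_sum hH, sum_apply]
  rfl

theorem pd_sqrt (hF : DifferentiableAt ℝ F x) (h0 : F x ≠ 0) (i : Fin n) :
    pd i (fun y ↦ √(F y)) x = pd i F x / (2 * √(F x)) := by
  simp [pd, (hF.hasFDerivAt.sqrt h0).fderiv, div_eq_inv_mul]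

theorem pd_pd_add (hF : ContDiffAt ℝ 2 F x) (hG : ContDiffAt ℝ 2 G x) (i j : Fin n) :
    pd i (pd j fun y ↦ F y + G y) x = pd i (pd j F) x + pd i (pd j G) x := by
  have h : pd j (fun y ↦ F y + G y) =ᶠ[𝓝 x] fun y ↦ pd j F y + pd j G y := by
    filter_upwards [hF.eventually (by simp), hG.eventually (by simp)] with y hFy hGy
    exact pd_add (hFy.differentiableAt (by simp)) (hGy.differentiableAt (by simp)) j
  rw [pd_congr h, pd_add (differentiableAt_pd hF j) (differentiableAt_pd hG j)]

theorem pd_pd_mul (hF : ContDiffAt ℝ 2 F x) (hG : ContDiffAt ℝ 2 G x) (i j : Fin n) :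
    pd i (pd j fun y ↦ F y * G y) x =
      F x * pd i (pd j G) x + G x * pd i (pd j F) x +
        (pd i F x * pd j G x + pd j F x * pd i G x) := by
  have h : pd j (fun y ↦ F y * G y) =ᶠ[𝓝 x] fun y ↦ pd j F y * G y + F y * pd j G y := by
    filter_upwards [hF.eventually (by simp), hG.eventually (by simp)] with y hFy hGy
    exact pd_mul (hFy.differentiableAt (by simp)) (hGy.differentiableAt (by simp)) j
  have hF' := hF.differentiableAt (by simp)
  have hG' := hG.differentiableAt (by simp)
  have hdF := differentiableAt_pd hF j
  have hdG := differentiableAt_pd hG j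
  rw [pd_congr h, pd_add (hdF.fun_mul hG') (hF'.fun_mul hdG), pd_mul hdF hG', pd_mul hF' hdG]
  ring

theorem pd_pd_eq_fderiv_fderiv (hF : ContDiffAt ℝ 2 F x) (i j : Fin n) :
    pd i (pd j F) x =
      fderiv ℝ (fderiv ℝ F) x (EuclideanSpace.single i 1) (EuclideanSpace.single j 1) := by
  have h : DifferentiableAt ℝ (fderiv ℝ F) x :=
    (hF.fderiv_right (m := 1) (by norm_num)).differentiableAt (by simp)
  change fderiv ℝ (fun y ↦ fderiv ℝ F y (EuclideanSpace.single j 1)) x _ = _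
  simp [fderiv_clm_apply h (differentiableAt_const _)]

theorem pd_comm (hF : ContDiffAt ℝ 2 F x) (i j : Fin n) :
    pd i (pd j F) x = pd j (pd i F) x := by
  rw [pd_pd_eq_fderiv_fderiv hF, pd_pd_eq_fderiv_fderiv hF]
  exact hF.isSymmSndFDerivAt (by simp) _ _

end PartialDerivatives

section SecondDerivativeTest

theorem deriv_deriv_nonpos_of_isLocalMax {φ : ℝ → ℝ} {t : ℝ} (hφ : ContinuousAt φ t)
    (hmax : IsLocalMax φ t) : deriv (deriv φ) t ≤ 0 := by
  by_contra! hpos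
  have hmin := isLocalMin_of_deriv_deriv_pos hpos hmax.deriv_eq_zero hφ
  have hconst : φ =ᶠ[𝓝 t] fun _ ↦ φ t := by
    filter_upwards [hmax, hmin] with s h₁ h₂ using le_antisymm h₁ h₂
  have hzero : deriv (deriv φ) t = 0 := by simp [hconst.deriv.deriv_eq]
  exact hpos.ne' hzero

theorem fderiv_fderiv_apply_self_nonpos_of_isLocalMax {F : Type*} [NormedAddCommGroup F]
    [NormedSpace ℝ F] {w : F → ℝ} {x : F} (hw : ContDiffAt ℝ 2 w x) (hmax : IsLocalMax w x)
    (v : F) : fderiv ℝ (fderiv ℝ w) x v v ≤ 0 := by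
  let l : ℝ → F := fun t ↦ x + t • v
  have hl0 : l 0 = x := by simp [l]
  have hlc : ContinuousAt l 0 := by fun_prop
  have hl : ∀ t, HasDerivAt l v t := fun t ↦ by
    simpa only [one_smul] using ((hasDerivAt_id' t).smul_const v).const_add x
  rw [← hl0] at hw hmax
  have hfirst : deriv (w ∘ l) =ᶠ[𝓝 0] fun t ↦ fderiv ℝ w (l t) v := by
    filter_upwards [hlc.eventually (hw.eventually (by simp))] with t ht
    exact ((ht.differentiableAt (by simp)).hasFDerivAt.comp_hasDerivAt t (hl t)).deriv
  have hsecond : deriv (deriv (w ∘ l)) 0 = fderiv ℝ (fderiv ℝ w) x v v := by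
    have hdw : DifferentiableAt ℝ (fderiv ℝ w) (l 0) :=
      (hw.fderiv_right (m := 1) (by norm_num)).differentiableAt (by simp)
    rw [hfirst.deriv_eq, ← hl0]
    simpa using ((hdw.hasFDerivAt.comp_hasDerivAt (0 : ℝ) (hl 0)).clm_apply
      (hasDerivAt_const (0 : ℝ) v)).deriv
  rw [← hsecond]
  exact deriv_deriv_nonpos_of_isLocalMax (hw.continuousAt.comp hlc)
    (hmax.comp_continuous hlc)

end SecondDerivativeTest

section MaximumPrinciple

variable {n : ℕ}

theorem posSemidef_neg_hessian_of_isLocalMax {w : E n → ℝ} {x : E n} (hw : ContDiffAt ℝ 2 w x)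
    (hmax : IsLocalMax w x) : (-Matrix.of fun i j ↦ pd i (pd j w) x).PosSemidef := by
  refine .of_dotProduct_mulVec_nonneg ?_ fun v ↦ ?_
  · ext i j
    simp [pd_comm hw i j]
  · have hquad : v ⬝ᵥ (Matrix.of fun i j ↦ pd i (pd j w) x).mulVec v =
        fderiv ℝ (fderiv ℝ w) x (WithLp.toLp 2 v) (WithLp.toLp 2 v) := by
      rw [clm_apply_eq_sum_single (fderiv ℝ (fderiv ℝ w) x), sum_apply]
      refine Finset.sum_congr rfl fun i _ ↦ ?_
      rw [smul_apply, clm_apply_eq_sum_single]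
      simp [Matrix.mulVec, dotProduct, pd_pd_eq_fderiv_fderiv hw, mul_comm]
    have := fderiv_fderiv_apply_self_nonpos_of_isLocalMax hw hmax (WithLp.toLp 2 v)
    simp only [star_trivial, Matrix.neg_mulVec, dotProduct_neg, hquad]
    linarith

theorem sum_sum_mul_nonneg_of_posSemidef {ι : Type*} [Fintype ι] {A B : Matrix ι ι ℝ}
    (hA : A.PosSemidef) (hB : B.PosSemidef) : 0 ≤ ∑ i, ∑ j, A i j * B i j := by
  classical
  simpa [dotProduct, Matrix.mulVec] using (hA.hadamard hB).dotProduct_mulVec_nonneg 1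

/-- The second order differential operator `aⁱʲ ∂ᵢ∂ⱼ + bᵏ ∂ₖ` without zeroth order term, for which
the maximum principle is proved. -/
noncomputable def secondOrderOp (a : E n → Matrix (Fin n) (Fin n) ℝ) (b : E n → Fin n → ℝ)
    (w : E n → ℝ) (x : E n) : ℝ :=
  ∑ i, ∑ j, a x i j * pd i (pd j w) x + ∑ k, b x k * pd k w x

variable {a : E n → Matrix (Fin n) (Fin n) ℝ} {b : E n → Fin n → ℝ} {u v : E n → ℝ} {x : E n}

theorem secondOrderOp_nonpos_of_isLocalMax (ha : (a x).PosSemidef) (hu : ContDiffAt ℝ 2 u x)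
    (hmax : IsLocalMax u x) : secondOrderOp a b u x ≤ 0 := by
  have hgrad : ∀ k, pd k u x = 0 := fun k ↦ by simp [pd, hmax.fderiv_eq_zero]
  have htrace := sum_sum_mul_nonneg_of_posSemidef ha (posSemidef_neg_hessian_of_isLocalMax hu hmax)
  simp only [Matrix.neg_apply, Matrix.of_apply, mul_neg, Finset.sum_neg_distrib] at htrace
  simpa [secondOrderOp, hgrad] using htrace

theorem secondOrderOp_add (hu : ContDiffAt ℝ 2 u x) (hv : ContDiffAt ℝ 2 v x) :
    secondOrderOp a b (fun y ↦ u y + v y) x = secondOrderOp a b u x + secondOrderOp a b v x := by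
  simp only [secondOrderOp, pd_pd_add hu hv,
    pd_add (hu.differentiableAt (by simp)) (hv.differentiableAt (by simp)), mul_add,
    Finset.sum_add_distrib]
  ring

theorem secondOrderOp_mul (hu : ContDiffAt ℝ 2 u x) (hv : ContDiffAt ℝ 2 v x) :
    secondOrderOp a b (fun y ↦ u y * v y) x =
      u x * secondOrderOp a b v x + v x * secondOrderOp a b u x +
        ∑ i, ∑ j, a x i j * (pd i u x * pd j v x + pd j u x * pd i v x) := by
  simp only [secondOrderOp, pd_pd_mul hu hv,
    pd_mul (hu.differentiableAt (by simp)) (hv.differentiableAt (by simp)), mul_add,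
    Finset.sum_add_distrib, Finset.mul_sum]
  simp only [mul_left_comm, mul_comm]
  ring

theorem secondOrderOp_const_mul (c : ℝ) (hu : ContDiffAt ℝ 2 u x) :
    secondOrderOp a b (fun y ↦ c * u y) x = c * secondOrderOp a b u x := by
  rw [secondOrderOp_mul contDiffAt_const hu]
  have hpd : ∀ k, (pd k fun _ : E n ↦ c) = fun _ ↦ 0 := fun k ↦ funext fun _ ↦ pd_const c k
  simp [secondOrderOp, hpd, pd_const]

theorem continuousAt_secondOrderOp (ha : ContinuousAt a x) (hb : ContinuousAt b x)
    (hu : ContDiffAt ℝ 2 u x) : ContinuousAt (secondOrderOp a b u) x := by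
  have hpd : ∀ k, ContDiffAt ℝ 1 (pd k u) x := contDiffAt_pd hu (by norm_num)
  have ha' : ∀ i j, ContinuousAt (fun y ↦ a y i j) x := fun i j ↦
    continuousAt_pi.mp (continuousAt_pi.mp ha i) j
  refine .add ?_ ?_
  · exact tendsto_finsetSum _ fun i _ ↦ tendsto_finsetSum _ fun j _ ↦
      (ha' i j).mul (contDiffAt_pd (m := 0) (hpd j) (by simp) i).continuousAt
  · exact tendsto_finsetSum _ fun k _ ↦ (continuousAt_pi.mp hb k).mul (hpd k).continuousAt

-- Since `s x = 0`, the operator maps `s²` to `2 aⁱʲ ∂ᵢs ∂ⱼs > 0` at `x`.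
theorem exists_secondOrderOp_add_const_mul_sq_pos {s : E n → ℝ} (ha : (a x).PosDef)
    (hs : ContDiffAt ℝ 2 s x) (hsx : s x = 0) (hds : fderiv ℝ s x ≠ 0) :
    ∃ β : ℝ, 0 < secondOrderOp a b (fun y ↦ s y + β * (s y * s y)) x := by
  set q := ∑ i, ∑ j, a x i j * (pd i s x * pd j s x) with hq
  have hqpos : 0 < q := by
    have hpd : (fun i ↦ pd i s x) ≠ 0 := fun h ↦ hds <| by
      ext v
      simp [fderiv_apply_eq_sum_pd, congrFun h]
    simpa only [star_trivial, dotProduct, Matrix.mulVec, Finset.mul_sum, mul_left_comm]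
      using ha.dotProduct_mulVec_pos hpd
  have hop : ∀ β : ℝ, secondOrderOp a b (fun y ↦ s y + β * (s y * s y)) x =
      secondOrderOp a b s x + β * (2 * q) := fun β ↦ by
    rw [secondOrderOp_add hs (contDiffAt_const.mul (hs.mul hs)),
      secondOrderOp_const_mul β (hs.mul hs), secondOrderOp_mul hs hs, hsx, hq]
    have hsymm : ∀ i j, pd i s x * pd j s x + pd j s x * pd i s x = 2 * (pd i s x * pd j s x) :=
      fun i j ↦ by ring
    simp only [hsymm, mul_left_comm _ (2 : ℝ), ← Finset.mul_sum, zero_mul, zero_add]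
  refine ⟨(1 - secondOrderOp a b s x) / (2 * q), ?_⟩
  rw [hop, div_mul_cancel₀ _ (by positivity)]
  linarith

theorem exists_pos_forall_add_mul_lt {X : Type*} [TopologicalSpace X] {K : Set X}
    (hK : IsCompact K) {u v : X → ℝ} (hu : ContinuousOn u K) (hv : ContinuousOn v K) {c : ℝ}
    (hle : ∀ x ∈ K, u x ≤ c) (hlt : ∀ x ∈ K, 0 ≤ v x → u x < c) :
    ∃ ε > 0, ∀ x ∈ K, u x + ε * v x < c := by
  have hsmall : ∀ᶠ ε : ℝ in 𝓝[>] 0, ∀ x ∈ K, u x + ε * v x < c := by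
    refine hK.induction_on (p := fun t ↦ ∀ᶠ ε : ℝ in 𝓝[>] 0, ∀ x ∈ t, u x + ε * v x < c)
      (by simp) (fun s t hst ht ↦ ht.mono fun ε h x hx ↦ h x (hst hx))
      (fun s t hs ht ↦ (hs.and ht).mono fun ε h x hx ↦ hx.elim (h.1 x) (h.2 x)) fun x hx ↦ ?_
    rcases lt_or_ge (v x) 0 with hneg | hnonneg
    · refine ⟨K ∩ {y | v y < 0},
        Filter.inter_mem self_mem_nhdsWithin ((hv x hx).eventually_lt_const hneg), ?_⟩
      filter_upwards [self_mem_nhdsWithin] with ε hε y ⟨hyK, (hy : v y < 0)⟩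
      linarith [hle y hyK, mul_neg_of_pos_of_neg hε hy]
    · obtain ⟨m, hum, hmc⟩ := exists_between (hlt x hx hnonneg)
      refine ⟨{y | u y < m} ∩ {y | v y < v x + 1}, Filter.inter_mem
        ((hu x hx).eventually_lt_const hum) ((hv x hx).eventually_lt_const (by simp)), ?_⟩
      have hlim : Filter.Tendsto (fun ε : ℝ ↦ m + ε * (v x + 1)) (𝓝[>] 0) (𝓝 m) :=
        Filter.Tendsto.mono_left (Continuous.tendsto' (by fun_prop) _ _ (by simp))
          nhdsWithin_le_nhds
      filter_upwards [self_mem_nhdsWithin, hlim.eventually_lt_const hmc] with ε hε hεc y ⟨huy, hvy⟩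
      exact (add_lt_add huy (mul_lt_mul_of_pos_left hvy hε)).trans hεc
  obtain ⟨ε, hε, hεpos⟩ := (hsmall.and self_mem_nhdsWithin).exists
  exact ⟨ε, hεpos, hε⟩

theorem exists_isLocalMax_add_const_mul {X : Type*} [PseudoMetricSpace X] [ProperSpace X]
    {u v : X → ℝ} {x : X} {δ : ℝ} (hδ : 0 < δ) (hu : ContinuousOn u (Metric.closedBall x δ))
    (hv : ContinuousOn v (Metric.closedBall x δ)) (hvx : v x = 0)
    (hle : ∀ y ∈ Metric.sphere x δ, u y ≤ u x)
    (hlt : ∀ y ∈ Metric.sphere x δ, 0 ≤ v y → u y < u x) :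
    ∃ ε > 0, ∃ y ∈ Metric.ball x δ, IsLocalMax (fun p ↦ u p + ε * v p) y := by
  have hsphere := Metric.sphere_subset_closedBall (x := x) (ε := δ)
  obtain ⟨ε, hε, hεlt⟩ := exists_pos_forall_add_mul_lt (isCompact_sphere x δ) (hu.mono hsphere)
    (hv.mono hsphere) hle hlt
  refine ⟨ε, hε, (isCompact_closedBall x δ).exists_isLocalMax_mem_open Metric.ball_subset_closedBall
    (hu.add (continuousOn_const.mul hv)) (Metric.mem_closedBall_self hδ.le) (fun y hy ↦ ?_)
    Metric.isOpen_ball⟩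
  rw [Metric.closedBall_sdiff_ball] at hy
  simpa [hvx] using hεlt y hy

theorem not_isLocalMax_of_forall_lt_of_nonneg {s : E n → ℝ} (hu : ContDiffAt ℝ 2 u x)
    (ha : ContinuousAt a x) (hpos : ∀ᶠ y in 𝓝 x, (a y).PosDef) (hb : ContinuousAt b x)
    (hL : ∀ᶠ y in 𝓝 x, 0 ≤ secondOrderOp a b u y) (hs : ContDiffAt ℝ 2 s x) (hsx : s x = 0)
    (hds : fderiv ℝ s x ≠ 0) (hlt : ∀ᶠ y in 𝓝[≠] x, 0 ≤ s y → u y < u x) :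
    ¬ IsLocalMax u x := by
  intro hmax
  obtain ⟨β, hβ⟩ := exists_secondOrderOp_add_const_mul_sq_pos (b := b) hpos.self_of_nhds hs hsx hds
  set v : E n → ℝ := fun y ↦ s y + β * (s y * s y)
  have hv : ContDiffAt ℝ 2 v x := hs.add (contDiffAt_const.mul (hs.mul hs))
  have hsign : ∀ᶠ y in 𝓝 x, 0 ≤ v y → 0 ≤ s y := by
    have hfactor : ∀ᶠ y in 𝓝 x, 0 < 1 + β * s y :=
      (continuousAt_const.add (continuousAt_const.mul hs.continuousAt)).eventually_const_lt
        (by simp [hsx])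
    have hv_mul : ∀ y, v y = s y * (1 + β * s y) := fun y ↦ by ring
    filter_upwards [hfactor] with y hy hvy
    rw [hv_mul] at hvy
    exact nonneg_of_mul_nonneg_left hvy hy
  have hnear : ∀ᶠ y in 𝓝 x, u y ≤ u x ∧ (y ≠ x → 0 ≤ v y → u y < u x) ∧
      ContDiffAt ℝ 2 u y ∧ ContDiffAt ℝ 2 v y ∧ (a y).PosDef ∧
      0 ≤ secondOrderOp a b u y ∧ 0 < secondOrderOp a b v y := by
    filter_upwards [hmax, eventually_nhdsWithin_iff.mp hlt, hsign, hu.eventually (by simp),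
      hv.eventually (by simp), hpos, hL,
      (continuousAt_secondOrderOp ha hb hv).eventually_const_lt hβ]
      with y h₁ h₂ h₃ h₄ h₅ h₆ h₇ h₈ using ⟨h₁, fun hne h ↦ h₂ hne (h₃ h), h₄, h₅, h₆, h₇, h₈⟩
  obtain ⟨δ, hδ, hball⟩ := Metric.nhds_basis_closedBall.mem_iff.mp hnear
  have hsphere := Metric.sphere_subset_closedBall (x := x) (ε := δ)
  obtain ⟨ε, hε, y, hy, hymax⟩ := exists_isLocalMax_add_const_mul hδ
    (fun y hy ↦ (hball hy).2.2.1.continuousAt.continuousWithinAt)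
    (fun y hy ↦ (hball hy).2.2.2.1.continuousAt.continuousWithinAt) (by simp [v, hsx])
    (fun y hy ↦ (hball (hsphere hy)).1)
    (fun y hy ↦ (hball (hsphere hy)).2.1 (Metric.ne_of_mem_sphere hy hδ.ne'))
  obtain ⟨-, -, huy, hvy, hay, hLu, hLv⟩ := hball (Metric.ball_subset_closedBall hy)
  have hle := secondOrderOp_nonpos_of_isLocalMax (b := b) hay.posSemidef
    (huy.add (contDiffAt_const.mul hvy)) hymax
  rw [secondOrderOp_add huy (contDiffAt_const.mul hvy), secondOrderOp_const_mul ε hvy] at hle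
  linarith [mul_pos hε hLv]

theorem dist_lt_dist_of_inner_sub_nonneg {F : Type*} [NormedAddCommGroup F]
    [InnerProductSpace ℝ F] {x y z : F} (hne : x ≠ z) (h : 0 ≤ inner ℝ (z - x) (x - y)) :
    dist x y < dist z y := by
  have hpos : 0 < ‖z - x‖ := norm_pos_iff.mpr (sub_ne_zero.mpr hne.symm)
  have hsq := norm_add_sq_real (z - x) (x - y)
  rw [sub_add_sub_cancel] at hsq
  rw [dist_eq_norm, dist_eq_norm]
  exact lt_of_pow_lt_pow_left₀ 2 (norm_nonneg _) (by nlinarith)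

-- The condition `⟪z - p, p - y⟫ < 0` says that `p` lies outside the closed ball with diameter
-- `[y, z]` (Thales), so this ball touches `A` in `z` only.
theorem exists_mem_forall_inner_sub_neg {F : Type*} [NormedAddCommGroup F]
    [InnerProductSpace ℝ F] {A : Set F} (hA : IsCompact A) {x : F} (hx : x ∈ A) (y : F) :
    ∃ z ∈ A, dist z y ≤ dist x y ∧ ∀ p ∈ A, p ≠ z → inner ℝ (z - p) (p - y) < 0 := by
  obtain ⟨z, hz, hmin⟩ := hA.exists_isMinOn ⟨x, hx⟩ (f := fun z ↦ dist z y) (by fun_prop)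
  refine ⟨z, hz, hmin hx, fun p hp hpz ↦ ?_⟩
  by_contra! h
  exact (hmin hp).not_gt (dist_lt_dist_of_inner_sub_nonneg hpz h)

theorem fderiv_inner_sub_sub_self {F : Type*} [NormedAddCommGroup F] [InnerProductSpace ℝ F]
    (y z w : F) : fderiv ℝ (fun x ↦ inner ℝ (z - x) (x - y)) z w = -inner ℝ w (z - y) := by
  rw [fderiv_inner_apply ℝ (by fun_prop) (by fun_prop), fderiv_const_sub, fderiv_sub_const]
  simp

theorem eventually_eq_of_isLocalMax_of_secondOrderOp_nonneg (hu : ContDiffAt ℝ 2 u x)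
    (ha : ∀ᶠ y in 𝓝 x, ContinuousAt a y) (hpos : ∀ᶠ y in 𝓝 x, (a y).PosDef)
    (hb : ∀ᶠ y in 𝓝 x, ContinuousAt b y) (hL : ∀ᶠ y in 𝓝 x, 0 ≤ secondOrderOp a b u y)
    (hmax : IsLocalMax u x) : ∀ᶠ y in 𝓝 x, u y = u x := by
  have hnear : ∀ᶠ y in 𝓝 x, ContDiffAt ℝ 2 u y ∧ ContinuousAt a y ∧ (a y).PosDef ∧
      ContinuousAt b y ∧ 0 ≤ secondOrderOp a b u y ∧ u y ≤ u x := by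
    filter_upwards [hu.eventually (by simp), ha, hpos, hb, hL, hmax]
      with y h₁ h₂ h₃ h₄ h₅ h₆ using ⟨h₁, h₂, h₃, h₄, h₅, h₆⟩
  obtain ⟨r, hr, hball⟩ := Metric.nhds_basis_closedBall.mem_iff.mp hnear
  set A := Metric.closedBall x r ∩ u ⁻¹' {u x}
  have hA : IsCompact A := (isCompact_closedBall x r).of_isClosed_subset
    (ContinuousOn.preimage_isClosed_of_isClosed
      (fun y hy ↦ (hball hy).1.continuousAt.continuousWithinAt) Metric.isClosed_closedBall
      isClosed_singleton) inter_subset_left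
  have hxA : x ∈ A := ⟨Metric.mem_closedBall_self hr.le, rfl⟩
  filter_upwards [Metric.ball_mem_nhds x (half_pos hr)] with y hy
  by_contra hne
  obtain ⟨z, hzA, hzx, hzmin⟩ := exists_mem_forall_inner_sub_neg hA hxA y
  have hzy : z ≠ y := by
    rintro rfl
    exact hne hzA.2
  have hzball : ∀ᶠ p in 𝓝 z, p ∈ Metric.closedBall x r :=
    Filter.mem_of_superset (Metric.isOpen_ball.mem_nhds <| by
      have := dist_triangle_right z x y
      have : dist x y < r / 2 := Metric.mem_ball'.mp hy
      rw [Metric.mem_ball]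
      linarith) Metric.ball_subset_closedBall
  obtain ⟨huz, haz, -, hbz, -, -⟩ := hball hzA.1
  have hle : ∀ p ∈ Metric.closedBall x r, u p ≤ u z := fun p hp ↦
    (hball hp).2.2.2.2.2.trans_eq hzA.2.symm
  refine not_isLocalMax_of_forall_lt_of_nonneg (s := fun p ↦ inner ℝ (z - p) (p - y)) huz haz
    (hzball.mono fun p hp ↦ (hball hp).2.2.1) hbz (hzball.mono fun p hp ↦ (hball hp).2.2.2.2.1)
    (.inner ℝ (by fun_prop) (by fun_prop)) (by simp) (fun h ↦ hzy ?_) ?_ (hzball.mono hle)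
  · simpa [h, sub_eq_zero] using fderiv_inner_sub_sub_self y z (z - y)
  · filter_upwards [nhdsWithin_le_nhds hzball, self_mem_nhdsWithin] with p hp hpz hsp
    exact (hle p hp).lt_of_ne fun hup ↦ (hzmin p ⟨hp, hup.trans hzA.2⟩ hpz).not_ge hsp

end MaximumPrinciple

section MatrixCalculus

variable {𝕜 F ι : Type*} [NontriviallyNormedField 𝕜] [NormedAddCommGroup F] [NormedSpace 𝕜 F]
  [Fintype ι] [DecidableEq ι] {A : F → Matrix ι ι 𝕜} {x : F} {k : ℕ∞ω}

theorem contDiffAt_det (hA : ∀ i j, ContDiffAt 𝕜 k (fun y ↦ A y i j) x) :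
    ContDiffAt 𝕜 k (fun y ↦ (A y).det) x := by
  simp only [Matrix.det_apply]
  exact .sum fun σ _ ↦ .const_smul _ (contDiffAt_prod fun i _ ↦ hA (σ i) i)

theorem contDiffAt_inv_apply (hA : ∀ i j, ContDiffAt 𝕜 k (fun y ↦ A y i j) x)
    (hdet : (A x).det ≠ 0) (i j : ι) : ContDiffAt 𝕜 k (fun y ↦ (A y)⁻¹ i j) x := by
  have hadj : ContDiffAt 𝕜 k (fun y ↦ (A y).adjugate i j) x := by
    simp only [Matrix.adjugate_apply]
    refine contDiffAt_det fun r c ↦ ?_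
    rcases eq_or_ne r j with rfl | hr
    · simpa only [Matrix.updateRow_self] using contDiffAt_const
    · simpa only [Matrix.updateRow_ne hr] using hA r c
  simpa only [Matrix.inv_def, Ring.inverse_eq_inv', Matrix.smul_apply, smul_eq_mul,
    Pi.inv_apply]
    using ((contDiffAt_det hA).inv hdet).mul hadj

theorem hasFDerivAt_det {A' : ι → ι → F →L[𝕜] 𝕜}
    (hA : ∀ i j, HasFDerivAt (fun y ↦ A y i j) (A' i j) x) :
    HasFDerivAt (fun y ↦ (A y).det) (∑ i, ∑ j, (A x).adjugate j i • A' i j) x := by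
  let D : ContinuousMultilinearMap 𝕜 (fun _ : ι ↦ ι → 𝕜) 𝕜 :=
    ⟨(Matrix.detRowAlternating (n := ι) (R := 𝕜)).toMultilinearMap,
      Continuous.matrix_det (A := fun M : Matrix ι ι 𝕜 ↦ M) continuous_id⟩
  refine (HasFDerivAt.multilinear_comp D (g := fun i y ↦ A y i)
    fun i ↦ hasFDerivAt_pi.mpr (hA i)).congr_fderiv ?_
  ext v
  simp only [sum_apply, ContinuousLinearMap.comp_apply, smul_apply, smul_eq_mul]
  refine Finset.sum_congr rfl fun i _ ↦ ?_
  trans ((A x).updateRow i fun j ↦ A' i j v).det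
  · rfl
  · rw [← Matrix.cramer_transpose_apply, Matrix.cramer_eq_adjugate_mulVec,
      ← Matrix.adjugate_transpose]
    rfl

end MatrixCalculus

section ChartCoordinates

variable {n : ℕ} {M : Type*} [TopologicalSpace M] [ChartedSpace (E n) M]
  {e : OpenPartialHomeomorph M (E n)}

theorem mfderiv_chart_symm_apply (x w : E n) :
    mfderiv (𝓡 n) (𝓡 n) e.symm x w = ∑ k, w k • frame e k x := by
  let A : E n →L[ℝ] E n := mfderiv (𝓡 n) (𝓡 n) e.symm x
  exact clm_apply_eq_sum_single A w

variable [IsManifold (𝓡 n) ∞ M] {x : E n}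

theorem contMDiffOn_chart_symm (he : e ∈ atlas (E n) M) :
    ContMDiffOn (𝓡 n) (𝓡 n) ∞ e.symm e.target :=
  contMDiffOn_symm_of_mem_maximalAtlas (IsManifold.subset_maximalAtlas he)

theorem contMDiffOn_chart (he : e ∈ atlas (E n) M) : ContMDiffOn (𝓡 n) (𝓡 n) ∞ e e.source :=
  contMDiffOn_of_mem_maximalAtlas (IsManifold.subset_maximalAtlas he)

theorem mdifferentiable_chart (he : e ∈ atlas (E n) M) : e.MDifferentiable (𝓡 n) (𝓡 n) :=
  have : IsManifold (𝓡 n) 1 M := IsManifold.of_le (n := ∞) (by simp)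
  mdifferentiable_of_mem_atlas he

theorem contMDiffOn_frame (he : e ∈ atlas (E n) M) (i : Fin n) :
    ContMDiffOn (𝓡 n) (𝓡 n).tangent ∞
      (fun x ↦ (⟨e.symm x, frame e i x⟩ : TangentBundle (𝓡 n) M)) e.target := by
  have : IsManifold (𝓡 n) 1 M := IsManifold.of_le (n := ∞) (by simp)
  have htangent := (contMDiffOn_chart_symm he).contMDiffOn_tangentMapWithin (m := ∞) (by simp)
    e.open_target.uniqueMDiffOn
  have hconst : ContMDiff (𝓡 n) (𝓡 n).tangent ∞
      (fun x : E n ↦ (⟨x, (EuclideanSpace.single i 1 : E n)⟩ : TangentBundle (𝓡 n) (E n))) :=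
    contMDiff_vectorSpace_iff_contDiff.mpr contDiff_const
  refine (htangent.comp hconst.contMDiffOn fun x hx ↦ hx).congr fun x hx ↦ ?_
  simp only [Function.comp, tangentMapWithin, mfderivWithin_of_isOpen e.open_target hx]
  rfl

theorem contDiffAt_gMat (g : Metric n M) (he : e ∈ atlas (E n) M) (hx : x ∈ e.target)
    (i j : Fin n) : ContDiffAt ℝ ∞ (fun y ↦ gMat g e y i j) x := by
  refine ContDiffOn.contDiffAt (contMDiffOn_iff_contDiffOn.mp fun y hy ↦ ?_)
    (e.open_target.mem_nhds hx)
  have hg := g.contMDiff.contMDiffOn.comp (t := univ) (contMDiffOn_chart_symm he) (by simp)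
  have h := ContMDiffOn.clm_bundle_apply₂ (F₁ := E n) (F₂ := E n) (F₃ := ℝ)
    (E₁ := fun p : M ↦ TangentSpace (𝓡 n) p) (E₂ := fun p : M ↦ TangentSpace (𝓡 n) p)
    (E₃ := Bundle.Trivial M ℝ) hg (contMDiffOn_frame he i) (contMDiffOn_frame he j)
  exact (contMDiffWithinAt_totalSpace.mp (h y hy)).2

theorem contDiffAt_vecComp (he : e ∈ atlas (E n) M) (hx : x ∈ e.target)
    {X : ∀ p : M, TangentSpace (𝓡 n) p} (hX : SmoothVectorField X) (i : Fin n) :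
    ContDiffAt ℝ ∞ (vecComp e X i) x := by
  have : IsManifold (𝓡 n) 1 M := IsManifold.of_le (n := ∞) (by simp)
  have htangent := (contMDiffOn_chart he).contMDiffOn_tangentMapWithin (m := ∞) (by simp)
    e.open_source.uniqueMDiffOn
  have hX' := hX.comp_contMDiffOn (contMDiffOn_chart_symm he)
  have hsnd := (contMDiff_snd_tangentBundle_modelSpace (n := ∞) (E n) (𝓡 n)).comp_contMDiffOn
    (htangent.comp hX' fun x hx ↦ e.map_target hx)
  have hcoord := (EuclideanSpace.proj i : E n →L[ℝ] ℝ).contDiff.comp_contDiffOn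
    (contMDiffOn_iff_contDiffOn.mp hsnd)
  refine (hcoord.congr fun y hy ↦ ?_).contDiffAt (e.open_target.mem_nhds hx)
  simp only [Function.comp, tangentMapWithin, vecComp,
    mfderivWithin_of_isOpen e.open_source (e.map_target hy)]

theorem contDiffAt_funComp {u : M → ℝ} {k : ℕ∞ω} (he : e ∈ atlas (E n) M) (hx : x ∈ e.target)
    (hu : ContMDiffAt (𝓡 n) 𝓘(ℝ, ℝ) k u (e.symm x)) (hk : k ≤ ∞) :
    ContDiffAt ℝ k (funComp e u) x :=
  contMDiffAt_iff_contDiffAt.mp <| hu.comp x <|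
    ((contMDiffOn_chart_symm he).contMDiffAt (e.open_target.mem_nhds hx)).of_le hk

theorem pd_funComp {u : M → ℝ} (he : e ∈ atlas (E n) M) (hx : x ∈ e.target)
    (hu : MDifferentiableAt (𝓡 n) 𝓘(ℝ, ℝ) u (e.symm x)) (j : Fin n) :
    pd j (funComp e u) x =
      (mfderiv (𝓡 n) 𝓘(ℝ, ℝ) u (e.symm x) : TangentSpace (𝓡 n) (e.symm x) →L[ℝ] ℝ)
        (frame e j x) := by
  have h := mfderiv_comp x hu ((mdifferentiable_chart he).mdifferentiableAt_symm hx)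
  rw [mfderiv_eq_fderiv] at h
  exact DFunLike.congr_fun h (EuclideanSpace.single j 1 : E n)

theorem sum_vecComp_smul_frame (he : e ∈ atlas (E n) M) (hx : x ∈ e.target)
    (X : ∀ p : M, TangentSpace (𝓡 n) p) : ∑ k, vecComp e X k x • frame e k x = X (e.symm x) := by
  have h := (mdifferentiable_chart he).symm_comp_deriv (e.map_target hx)
  rw [e.right_inv hx] at h
  exact (mfderiv_chart_symm_apply x _).symm.trans (DFunLike.congr_fun h (X (e.symm x)))

theorem eq_zero_of_sum_smul_frame_eq_zero (he : e ∈ atlas (E n) M) (hx : x ∈ e.target)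
    {c : Fin n → ℝ} (hc : ∑ k, c k • frame e k x = 0) : c = 0 := by
  have hleft : mfderiv (𝓡 n) (𝓡 n) e (e.symm x) (mfderiv (𝓡 n) (𝓡 n) e.symm x
      (WithLp.toLp 2 c : E n)) = (WithLp.toLp 2 c : E n) :=
    DFunLike.congr_fun ((mdifferentiable_chart he).comp_symm_deriv hx) (WithLp.toLp 2 c : E n)
  have hzero : mfderiv (𝓡 n) (𝓡 n) e.symm x (WithLp.toLp 2 c : E n) = 0 :=
    (mfderiv_chart_symm_apply x _).trans hc
  rw [hzero, map_zero] at hleft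
  funext i
  exact (congrArg (fun w : E n ↦ w i) hleft).symm

theorem isSymm_gMat (g : Metric n M) (e : OpenPartialHomeomorph M (E n)) (x : E n) :
    (gMat g e x).IsSymm :=
  Matrix.IsSymm.ext fun _ _ ↦ g.symm _ _ _

theorem posDef_gMat (g : Metric n M) (he : e ∈ atlas (E n) M) (hx : x ∈ e.target) :
    (gMat g e x).PosDef := by
  refine .of_dotProduct_mulVec_pos (isSymm_gMat g e x) fun c hc ↦ ?_
  have hv : ∑ k, c k • frame e k x ≠ 0 := fun h ↦ hc (eq_zero_of_sum_smul_frame_eq_zero he hx h)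
  refine (g.pos _ _ hv).trans_eq ?_
  simp only [map_sum, map_smul, sum_apply, smul_apply, smul_eq_mul, dotProduct, Matrix.mulVec,
    gMat, Matrix.of_apply, Finset.mul_sum, star_trivial]
  rw [Finset.sum_comm]
  exact Finset.sum_congr rfl fun i _ ↦ Finset.sum_congr rfl fun j _ ↦ by ring

theorem inv_gMat_mul_gMat (g : Metric n M) (he : e ∈ atlas (E n) M) (hx : x ∈ e.target) :
    (gMat g e x)⁻¹ * gMat g e x = 1 :=
  Matrix.nonsing_inv_mul _ (posDef_gMat g he hx).det_pos.ne'.isUnit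

theorem contDiffAt_inv_gMat (g : Metric n M) (he : e ∈ atlas (E n) M) (hx : x ∈ e.target)
    (i j : Fin n) : ContDiffAt ℝ ∞ (fun y ↦ (gMat g e y)⁻¹ i j) x :=
  contDiffAt_inv_apply (contDiffAt_gMat g he hx) (posDef_gMat g he hx).det_pos.ne' i j

theorem sum_vecComp_grad_mul_gMat {g : Metric n M} {u : M → ℝ} (he : e ∈ atlas (E n) M)
    (hx : x ∈ e.target) (hu : MDifferentiableAt (𝓡 n) 𝓘(ℝ, ℝ) u (e.symm x)) (j : Fin n) :
    ∑ k, vecComp e (grad g u) k x * gMat g e x k j = pd j (funComp e u) x := by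
  rw [pd_funComp he hx hu, ← inner_grad, ← sum_vecComp_smul_frame he hx (grad g u)]
  simp [gMat]

theorem vecComp_grad {g : Metric n M} {u : M → ℝ} (he : e ∈ atlas (E n) M)
    (hx : x ∈ e.target) (hu : MDifferentiableAt (𝓡 n) 𝓘(ℝ, ℝ) u (e.symm x)) (i : Fin n) :
    vecComp e (grad g u) i x = ∑ k, (gMat g e x)⁻¹ k i * pd k (funComp e u) x := by
  have hlower : Matrix.vecMul (fun k ↦ vecComp e (grad g u) k x) (gMat g e x) =
      fun k ↦ pd k (funComp e u) x := funext (sum_vecComp_grad_mul_gMat he hx hu)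
  have hraise : (fun k ↦ vecComp e (grad g u) k x) =
      Matrix.vecMul (fun k ↦ pd k (funComp e u) x) (gMat g e x)⁻¹ := by
    rw [← hlower, Matrix.vecMul_vecMul, Matrix.mul_nonsing_inv _
      (posDef_gMat g he hx).det_pos.ne'.isUnit, Matrix.vecMul_one]
  simpa only [Matrix.vecMul, dotProduct, mul_comm] using congrFun hraise i

theorem differentiableAt_vecComp_grad {g : Metric n M} {u : M → ℝ} (he : e ∈ atlas (E n) M)
    (hx : x ∈ e.target) (hu : ContMDiff (𝓡 n) 𝓘(ℝ, ℝ) 2 u) (i : Fin n) :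
    DifferentiableAt ℝ (vecComp e (grad g u) i) x := by
  have hformula : vecComp e (grad g u) i =ᶠ[𝓝 x]
      fun y ↦ ∑ k, (gMat g e y)⁻¹ k i * pd k (funComp e u) y := by
    filter_upwards [e.open_target.mem_nhds hx] with y hy
    exact vecComp_grad he hy (hu.mdifferentiable (by simp) _) i
  refine hformula.differentiableAt_iff.mpr <| .fun_sum fun k _ ↦
    ((contDiffAt_inv_gMat g he hx k i).differentiableAt (by simp)).mul
      (differentiableAt_pd (contDiffAt_funComp he hx (hu _) ?_) k)
  exact WithTop.coe_le_coe.mpr le_top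

end ChartCoordinates

section TensorTraces

variable {n : ℕ} {M : Type*} [TopologicalSpace M] [ChartedSpace (E n) M] [IsManifold (𝓡 n) ∞ M]
  {e : OpenPartialHomeomorph M (E n)} {g : Metric n M} {x : E n}

/-- The metric trace `gⁱʲ Tⱼᵢ` of a bilinear form with components `Tⱼᵢ` in the chart `e`. -/
noncomputable def metricTrace (g : Metric n M) (e : OpenPartialHomeomorph M (E n)) (x : E n) :
    Matrix (Fin n) (Fin n) ℝ →ₗ[ℝ] ℝ :=
  Matrix.traceLinearMap (Fin n) ℝ ℝ ∘ₗ LinearMap.mulLeft ℝ (gMat g e x)⁻¹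

theorem metricTrace_apply (T : Matrix (Fin n) (Fin n) ℝ) :
    metricTrace g e x T = ((gMat g e x)⁻¹ * T).trace :=
  rfl

theorem metricTrace_eq_sum (T : Matrix (Fin n) (Fin n) ℝ) :
    metricTrace g e x T = ∑ i, ∑ j, (gMat g e x)⁻¹ i j * T i j := by
  simp only [metricTrace_apply, Matrix.trace, Matrix.diag_apply, Matrix.mul_apply]
  rw [Finset.sum_comm]
  exact Finset.sum_congr rfl fun i _ ↦ Finset.sum_congr rfl fun j _ ↦ by
    rw [(isSymm_gMat g e x).inv.apply]

/-- The Laplace–Beltrami operator, as the metric trace of the Hessian. -/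
noncomputable def laplacian (g : Metric n M) (e : OpenPartialHomeomorph M (E n)) (u : M → ℝ)
    (x : E n) : ℝ :=
  metricTrace g e x (Matrix.of fun i j ↦ hess g e u i j x)

theorem metricTrace_mul_gMat (he : e ∈ atlas (E n) M) (hx : x ∈ e.target)
    (J : Matrix (Fin n) (Fin n) ℝ) : metricTrace g e x (J * gMat g e x) = J.trace := by
  rw [metricTrace_apply, Matrix.trace_mul_comm, Matrix.mul_assoc, Matrix.mul_nonsing_inv _
    (posDef_gMat g he hx).det_pos.ne'.isUnit, Matrix.mul_one]

theorem metricTrace_gMat_mul (he : e ∈ atlas (E n) M) (hx : x ∈ e.target)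
    (J : Matrix (Fin n) (Fin n) ℝ) : metricTrace g e x (gMat g e x * J) = J.trace := by
  rw [metricTrace_apply, ← Matrix.mul_assoc, inv_gMat_mul_gMat g he hx, Matrix.one_mul]

theorem pd_det_gMat (he : e ∈ atlas (E n) M) (hx : x ∈ e.target) (k : Fin n) :
    pd k (fun y ↦ (gMat g e y).det) x = (gMat g e x).det *
      metricTrace g e x (Matrix.of fun i j ↦ pd k (fun y ↦ gMat g e y i j) x) := by
  have hJacobi := hasFDerivAt_det fun i j ↦
    ((contDiffAt_gMat g he hx i j).differentiableAt (by simp)).hasFDerivAt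
  have hadj : (gMat g e x).adjugate = (gMat g e x).det • (gMat g e x)⁻¹ := by
    rw [Matrix.inv_def, Ring.inverse_eq_inv', smul_smul,
      mul_inv_cancel₀ (posDef_gMat g he hx).det_pos.ne', one_smul]
  rw [pd, hJacobi.fderiv, hadj, metricTrace_apply, Matrix.trace, Finset.mul_sum, Finset.sum_comm,
    sum_apply]
  simp [Matrix.mul_apply, Finset.mul_sum, mul_assoc, pd]

theorem divergence_eq (he : e ∈ atlas (E n) M) (hx : x ∈ e.target)
    {X : ∀ p : M, TangentSpace (𝓡 n) p} (hX : ∀ k, DifferentiableAt ℝ (vecComp e X k) x) :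
    divergence g e X x = ∑ k, (pd k (vecComp e X k) x + (1 / 2) * (vecComp e X k x *
      metricTrace g e x (Matrix.of fun i j ↦ pd k (fun y ↦ gMat g e y i j) x))) := by
  have hdet := (posDef_gMat g he hx).det_pos
  have hd : DifferentiableAt ℝ (fun y ↦ (gMat g e y).det) x :=
    (contDiffAt_det (contDiffAt_gMat g he hx)).differentiableAt (by simp)
  rw [divergence, Finset.mul_sum]
  refine Finset.sum_congr rfl fun k _ ↦ ?_
  rw [pd_mul (hd.sqrt hdet.ne') (hX k), pd_sqrt hd hdet.ne', pd_det_gMat he hx]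
  nth_rewrite 2 [← Real.mul_self_sqrt hdet.le]
  field_simp
  ring

theorem of_lieMetric_eq (X : ∀ p : M, TangentSpace (𝓡 n) p) :
    (Matrix.of fun i j ↦ lieMetric g e X i j x) =
      ∑ k, vecComp e X k x • (Matrix.of fun i j ↦ pd k (fun y ↦ gMat g e y i j) x) +
        (Matrix.of fun i k ↦ pd i (vecComp e X k) x) * gMat g e x +
        gMat g e x * (Matrix.of fun i k ↦ pd i (vecComp e X k) x).transpose := by
  ext i j
  simp [lieMetric, Matrix.mul_apply, Matrix.sum_apply, Finset.sum_add_distrib, mul_comm]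

theorem metricTrace_lieMetric (he : e ∈ atlas (E n) M) (hx : x ∈ e.target)
    {X : ∀ p : M, TangentSpace (𝓡 n) p} (hX : ∀ k, DifferentiableAt ℝ (vecComp e X k) x) :
    metricTrace g e x (Matrix.of fun i j ↦ lieMetric g e X i j x) = 2 * divergence g e X x := by
  rw [of_lieMetric_eq, map_add, map_add, map_sum, metricTrace_mul_gMat he hx,
    metricTrace_gMat_mul he hx, Matrix.trace_transpose, divergence_eq he hx hX, Matrix.trace,
    Finset.sum_add_distrib, ← Finset.mul_sum]
  simp only [map_smul, smul_eq_mul, Matrix.diag_apply, Matrix.of_apply]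
  ring

theorem divergence_eq_laplacian_of_lieMetric_eq {u : M → ℝ} (he : e ∈ atlas (E n) M)
    (hx : x ∈ e.target) {X : ∀ p : M, TangentSpace (𝓡 n) p}
    (hX : ∀ k, DifferentiableAt ℝ (vecComp e X k) x)
    (h : ∀ i j, lieMetric g e X i j x = 2 * hess g e u i j x) :
    divergence g e X x = laplacian g e u x := by
  have hLie : (Matrix.of fun i j ↦ lieMetric g e X i j x) =
      (2 : ℝ) • Matrix.of fun i j ↦ hess g e u i j x :=
    Matrix.ext h
  have htrace := metricTrace_lieMetric (g := g) he hx hX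
  rw [hLie, map_smul, smul_eq_mul] at htrace
  exact (mul_left_cancel₀ two_ne_zero htrace).symm

theorem sum_pd_vecComp_grad_mul_gMat {u : M → ℝ} (he : e ∈ atlas (E n) M) (hx : x ∈ e.target)
    (hu : ContMDiff (𝓡 n) 𝓘(ℝ, ℝ) 2 u) (i j : Fin n) :
    ∑ k, pd i (vecComp e (grad g u) k) x * gMat g e x k j = pd i (pd j (funComp e u)) x -
      ∑ k, vecComp e (grad g u) k x * pd i (fun y ↦ gMat g e y k j) x := by
  have hG : ∀ k, DifferentiableAt ℝ (fun y ↦ gMat g e y k j) x := fun k ↦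
    (contDiffAt_gMat g he hx k j).differentiableAt (by simp)
  have hV := differentiableAt_vecComp_grad (g := g) he hx hu
  have hlower : (fun y ↦ ∑ k, vecComp e (grad g u) k y * gMat g e y k j) =ᶠ[𝓝 x]
      pd j (funComp e u) := by
    filter_upwards [e.open_target.mem_nhds hx] with y hy
    exact sum_vecComp_grad_mul_gMat he hy (hu.mdifferentiable (by simp) _) j
  rw [← pd_congr hlower, pd_sum _ fun k _ ↦ (hV k).fun_mul (hG k), ← Finset.sum_sub_distrib]
  simp only [pd_mul (hV _) (hG _), add_sub_cancel_right]

theorem sum_christoffel_mul_pd {u : M → ℝ} (he : e ∈ atlas (E n) M) (hx : x ∈ e.target)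
    (hu : MDifferentiableAt (𝓡 n) 𝓘(ℝ, ℝ) u (e.symm x)) (i j : Fin n) :
    ∑ k, christoffel g e k i j x * pd k (funComp e u) x =
      (1 / 2) * ∑ l, vecComp e (grad g u) l x * (pd i (fun y ↦ gMat g e y j l) x +
        pd j (fun y ↦ gMat g e y i l) x - pd l (fun y ↦ gMat g e y i j) x) := by
  simp only [vecComp_grad he hx hu, christoffel, Finset.mul_sum, Finset.sum_mul]
  rw [Finset.sum_comm]
  exact Finset.sum_congr rfl fun l _ ↦ Finset.sum_congr rfl fun k _ ↦ by ring

theorem lieMetric_grad {u : M → ℝ} (he : e ∈ atlas (E n) M) (hx : x ∈ e.target)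
    (hu : ContMDiff (𝓡 n) 𝓘(ℝ, ℝ) 2 u) (i j : Fin n) :
    lieMetric g e (grad g u) i j x = 2 * hess g e u i j x := by
  have hG : ∀ y k l, gMat g e y k l = gMat g e y l k := fun y k l ↦ (isSymm_gMat g e y).apply l k
  have hsymm : pd j (pd i (funComp e u)) x = pd i (pd j (funComp e u)) x :=
    pd_comm (contDiffAt_funComp he hx (hu _) (WithTop.coe_le_coe.mpr le_top)) j i
  rw [hess, sum_christoffel_mul_pd he hx (hu.mdifferentiable (by simp) _), lieMetric]
  simp only [hG _ i, Finset.sum_add_distrib, sum_pd_vecComp_grad_mul_gMat he hx hu, hsymm]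
  simp only [mul_sub, mul_add, Finset.sum_sub_distrib, Finset.sum_add_distrib, hG]
  ring

theorem divergence_grad {u : M → ℝ} (he : e ∈ atlas (E n) M) (hx : x ∈ e.target)
    (hu : ContMDiff (𝓡 n) 𝓘(ℝ, ℝ) 2 u) : divergence g e (grad g u) x = laplacian g e u x :=
  divergence_eq_laplacian_of_lieMetric_eq he hx (differentiableAt_vecComp_grad he hx hu)
    (lieMetric_grad he hx hu)

theorem divergence_add (he : e ∈ atlas (E n) M) (hx : x ∈ e.target)
    {X Y Z : ∀ p : M, TangentSpace (𝓡 n) p} (h : ∀ p, X p = Y p + Z p)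
    (hY : ∀ k, DifferentiableAt ℝ (vecComp e Y k) x)
    (hZ : ∀ k, DifferentiableAt ℝ (vecComp e Z k) x) :
    divergence g e X x = divergence g e Y x + divergence g e Z x := by
  have hd : DifferentiableAt ℝ (fun y ↦ √(gMat g e y).det) x :=
    ((contDiffAt_det (contDiffAt_gMat g he hx)).differentiableAt (by simp)).sqrt
      (posDef_gMat g he hx).det_pos.ne'
  have hX : ∀ k y, vecComp e X k y = vecComp e Y k y + vecComp e Z k y := fun k y ↦ by
    simp only [vecComp, h, map_add]
    exact map_add (EuclideanSpace.proj k : E n →L[ℝ] ℝ) _ _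
  simp only [divergence, hX, mul_add, pd_add (hd.fun_mul (hY _)) (hd.fun_mul (hZ _)),
    Finset.sum_add_distrib]

end TensorTraces

section Laplacian

variable {n : ℕ} {M : Type*} [TopologicalSpace M] [ChartedSpace (E n) M] [IsManifold (𝓡 n) ∞ M]
  {e : OpenPartialHomeomorph M (E n)} {x : E n}

theorem continuousAt_christoffel (g : Metric n M) (he : e ∈ atlas (E n) M) (hx : x ∈ e.target)
    (k i j : Fin n) : ContinuousAt (christoffel g e k i j) x := by
  have hpd : ∀ l i j, ContinuousAt (pd l fun y ↦ gMat g e y i j) x := fun l i j ↦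
    (contDiffAt_pd (m := 0) (contDiffAt_gMat g he hx i j) (by simp) l).continuousAt
  exact continuousAt_const.mul <| tendsto_finsetSum _ fun l _ ↦
    (contDiffAt_inv_gMat g he hx k l).continuousAt.mul
      (((hpd i j l).add (hpd j i l)).sub (hpd l i j))

/-- The coefficients `-gⁱʲ Γᵏᵢⱼ` of the first order part of the Laplace–Beltrami operator. -/
noncomputable def laplaceDrift (g : Metric n M) (e : OpenPartialHomeomorph M (E n)) (x : E n)
    (k : Fin n) : ℝ :=
  -∑ i, ∑ j, (gMat g e x)⁻¹ i j * christoffel g e k i j x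

theorem continuousAt_laplaceDrift (g : Metric n M) (he : e ∈ atlas (E n) M) (hx : x ∈ e.target) :
    ContinuousAt (laplaceDrift g e) x :=
  continuousAt_pi.mpr fun k ↦ .neg <| tendsto_finsetSum _ fun i _ ↦ tendsto_finsetSum _ fun j _ ↦
    (contDiffAt_inv_gMat g he hx i j).continuousAt.mul (continuousAt_christoffel g he hx k i j)

theorem laplacian_eq_secondOrderOp (g : Metric n M) (e : OpenPartialHomeomorph M (E n))
    (u : M → ℝ) (x : E n) :
    laplacian g e u x =
      secondOrderOp (fun y ↦ (gMat g e y)⁻¹) (laplaceDrift g e) (funComp e u) x := by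
  simp only [laplacian, metricTrace_eq_sum, Matrix.of_apply, secondOrderOp, hess, mul_sub,
    Finset.sum_sub_distrib, laplaceDrift, neg_mul, Finset.sum_neg_distrib, Finset.sum_mul,
    Finset.mul_sum, ← sub_eq_add_neg, ← mul_assoc]
  congr 1
  rw [eq_comm, Finset.sum_comm]
  exact Finset.sum_congr rfl fun i _ ↦ Finset.sum_comm

theorem laplacian_sub (g : Metric n M) (he : e ∈ atlas (E n) M) (hx : x ∈ e.target) {u v : M → ℝ}
    (hu : ContMDiff (𝓡 n) 𝓘(ℝ, ℝ) 2 u) (hv : ContMDiff (𝓡 n) 𝓘(ℝ, ℝ) 2 v) :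
    laplacian g e (fun p ↦ u p - v p) x = laplacian g e u x - laplacian g e v x := by
  have hu' := contDiffAt_funComp he hx (hu _) (WithTop.coe_le_coe.mpr le_top)
  have hv' := contDiffAt_funComp he hx (hv _) (WithTop.coe_le_coe.mpr le_top)
  have hsub : funComp e (fun p ↦ u p - v p) = fun y ↦ funComp e u y + (-1) * funComp e v y := by
    funext y
    simp only [funComp]
    ring
  simp only [laplacian_eq_secondOrderOp]
  rw [hsub, secondOrderOp_add hu' (contDiffAt_const.mul hv'), secondOrderOp_const_mul _ hv']
  ring

theorem eventually_eq_of_isLocalMax_of_laplacian_nonneg (g : Metric n M) {u : M → ℝ} {p : M}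
    (he : e ∈ atlas (E n) M) (hp : p ∈ e.source) (hu : ContMDiff (𝓡 n) 𝓘(ℝ, ℝ) 2 u)
    (hL : ∀ x ∈ e.target, 0 ≤ laplacian g e u x) (hmax : IsLocalMax u p) :
    ∀ᶠ q in 𝓝 p, u q = u p := by
  have hx := e.map_source hp
  have htarget := e.open_target.mem_nhds hx
  have hmax' : IsLocalMax (funComp e u) (e p) := by
    rw [← e.left_inv hp] at hmax
    exact hmax.comp_continuous (e.continuousAt_symm hx)
  have ha : ∀ y ∈ e.target, ContinuousAt (fun y ↦ (gMat g e y)⁻¹) y := fun y hy ↦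
    continuousAt_pi.mpr fun i ↦ continuousAt_pi.mpr fun j ↦
      (contDiffAt_inv_gMat g he hy i j).continuousAt
  have hloc := eventually_eq_of_isLocalMax_of_secondOrderOp_nonneg (b := laplaceDrift g e)
    (contDiffAt_funComp he hx (hu _) (WithTop.coe_le_coe.mpr le_top))
    (Filter.mem_of_superset htarget ha)
    (Filter.mem_of_superset htarget fun y hy ↦ (posDef_gMat g he hy).inv)
    (Filter.mem_of_superset htarget fun y hy ↦ continuousAt_laplaceDrift g he hy)
    (Filter.mem_of_superset htarget fun y hy ↦
      (hL y hy).trans_eq (laplacian_eq_secondOrderOp g e u y)) hmax'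
  filter_upwards [(e.continuousAt hp).eventually hloc, e.open_source.mem_nhds hp] with q hq hqs
  simpa only [funComp, e.left_inv hp, e.left_inv hqs] using hq

theorem exists_eq_const_of_laplacian_nonneg [CompactSpace M] [ConnectedSpace M] (g : Metric n M)
    {u : M → ℝ} (hu : ContMDiff (𝓡 n) 𝓘(ℝ, ℝ) 2 u)
    (hL : ∀ e ∈ atlas (E n) M, ∀ x ∈ e.target, 0 ≤ laplacian g e u x) : ∃ c, ∀ p, u p = c := by
  obtain ⟨p₀, -, hp₀⟩ := isCompact_univ.exists_isMaxOn univ_nonempty hu.continuous.continuousOn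
  have hclopen : IsClopen {p | u p = u p₀} := by
    refine ⟨isClosed_eq hu.continuous continuous_const, isOpen_iff_mem_nhds.mpr fun q hq ↦ ?_⟩
    have hq : u q = u p₀ := hq
    have hmax : IsLocalMax u q := .of_forall fun p ↦ hq ▸ hp₀ (mem_univ p)
    have he := chart_mem_atlas (E n) q
    filter_upwards [eventually_eq_of_isLocalMax_of_laplacian_nonneg g he (mem_chart_source _ q) hu
      (hL _ he) hmax] with p hp using hp.trans hq
  exact ⟨u p₀, fun p ↦ (hclopen.eq_univ ⟨p₀, rfl⟩).ge (mem_univ p)⟩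

end Laplacian

section Solitons

variable {n : ℕ} {M : Type*} [TopologicalSpace M] [ChartedSpace (E n) M] [IsManifold (𝓡 n) ∞ M]
  {e : OpenPartialHomeomorph M (E n)} {g : Metric n M} {x : E n}
  {X : ∀ p : M, TangentSpace (𝓡 n) p}

theorem IsHodgeDeRhamPotential.divergence_eq_laplacian {h : M → ℝ}
    (hpot : IsHodgeDeRhamPotential g X h) (he : e ∈ atlas (E n) M) (hx : x ∈ e.target) :
    divergence g e X x = laplacian g e h x := by
  obtain ⟨hh, Y, hY, hdiv, hXY⟩ := hpot
  have hh : ContMDiff (𝓡 n) 𝓘(ℝ, ℝ) 2 h := hh.of_le (WithTop.coe_le_coe.mpr le_top)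
  rw [divergence_add he hx hXY (differentiableAt_vecComp_grad he hx hh)
    (fun k ↦ (contDiffAt_vecComp he hx hY k).differentiableAt (by simp)), hdiv e he x hx,
    add_zero, divergence_grad he hx hh]

theorem IsAlmostEtaRicciSoliton.divergence_eq_laplacian {lam mu f : M → ℝ}
    {η : ∀ p : M, TangentSpace (𝓡 n) p →L[ℝ] ℝ} (hsol : IsAlmostEtaRicciSoliton g X lam mu η)
    (hgrad : IsGradientAlmostEtaRicciSoliton g f lam mu η) (he : e ∈ atlas (E n) M)
    (hx : x ∈ e.target) : divergence g e X x = laplacian g e f x :=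
  divergence_eq_laplacian_of_lieMetric_eq he hx
    (fun k ↦ (contDiffAt_vecComp he hx hsol.smooth_X k).differentiableAt (by simp))
    fun i j ↦ by linarith [hsol.eqn e he x hx i j, hgrad.eqn e he x hx i j]

end Solitons

end Riem

theorem theorem1_general {n : ℕ} {M : Type*} [TopologicalSpace M] [CompactSpace M]
    [ConnectedSpace M] [ChartedSpace (Riem.E n) M] [IsManifold (𝓡 n) ∞ M]
    (g : Riem.Metric n M) (X : ∀ p : M, TangentSpace (𝓡 n) p) (h f : M → ℝ)
    (hpot : Riem.IsHodgeDeRhamPotential g X h) (hf : ContMDiff (𝓡 n) 𝓘(ℝ, ℝ) 2 f)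
    (hle : ∀ e ∈ atlas (Riem.E n) M, ∀ x ∈ e.target,
      Riem.divergence g e X x ≤ Riem.laplacian g e f x) :
    ∃ c : ℝ, ∀ p : M, f p = h p + c := by
  have hh : ContMDiff (𝓡 n) 𝓘(ℝ, ℝ) 2 h := hpot.1.of_le (WithTop.coe_le_coe.mpr le_top)
  obtain ⟨c, hc⟩ := Riem.exists_eq_const_of_laplacian_nonneg g (hf.sub hh) fun e he x hx ↦ by
    change 0 ≤ Riem.laplacian g e (fun p ↦ f p - h p) x
    rw [Riem.laplacian_sub g he hx hf hh, ← hpot.divergence_eq_laplacian he hx]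
    exact sub_nonneg.mpr (hle e he x hx)
  exact ⟨c, fun p ↦ sub_eq_iff_eq_add'.mp (hc p)⟩

theorem theorem1 {n : ℕ} {M : Type*} [TopologicalSpace M] [T2Space M] [CompactSpace M]
    [ConnectedSpace M] [ChartedSpace (Riem.E n) M] [IsManifold (𝓡 n) ∞ M]
    (g : Riem.Metric n M) (X : ∀ p : M, TangentSpace (𝓡 n) p) (lam mu : M → ℝ)
    (η : ∀ p : M, TangentSpace (𝓡 n) p →L[ℝ] ℝ) (h f : M → ℝ)
    (hsol : Riem.IsAlmostEtaRicciSoliton g X lam mu η)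
    (hpot : Riem.IsHodgeDeRhamPotential g X h)
    (hgrad : Riem.IsGradientAlmostEtaRicciSoliton g f lam mu η) :
    ∃ c : ℝ, ∀ p : M, f p = h p + c := by
  exact theorem1_general g X h f hpot (hgrad.smooth_f.of_le (WithTop.coe_le_coe.mpr le_top))
    fun _ he _ hx ↦ (hsol.divergence_eq_laplacian hgrad he hx).le
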